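/- Let $0\le r<1$. Starting from an arbitrary finite seed tree $T_0$, grow a random sequence of trees $T_0,T_1,T_2,\dots$ by the constant redirection (CR) model with $\alpha=\infty$: given $T_0,\dots,T_n$, choose a target vertex uniformly at random among the vertices of highest degree in $T_n$; with probability $1-r$ join a new vertex by an edge to the target, and with probability $r$ join it instead to a uniformly random neighbour of the target (if $T_n$ is a single vertex, which has no neighbour, the new vertex is joined to that vertex). The resulting tree is $T_{n+1}$. Then, almost surely, the diameter of the growing tree stays finite, i.e. $$\sup_{n\ge 0}\operatorname{diam}(T_n)<\infty .$$ -/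

import Mathlib

open MeasureTheory ProbabilityTheory

noncomputable section

instance {V : Type*} [Finite V] : MeasurableSingletonClass (SimpleGraph V) where
  measurableSet_singleton G := by
    have h : ({G} : Set (SimpleGraph V)) = SimpleGraph.edgeSet ⁻¹' {G.edgeSet} := by
      ext H; simp
    rw [h]
    exact SimpleGraph.measurable_edgeSet (measurableSet_singleton _)

open Classical in
/-- The kings of a finite graph: its vertices of highest degree. -/
def kings {V : Type*} [Fintype V] (G : SimpleGraph V) : Finset V :=
  Finset.univ.filter (fun v => ∀ w, G.degree w ≤ G.degree v)

theorem kings_nonempty {V : Type*} [Fintype V] [Nonempty V] (G : SimpleGraph V) :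
    (kings G).Nonempty := by
  classical
  obtain ⟨v, hv⟩ := Finite.exists_max (fun v => G.degree v)
  exact ⟨v, by simpa [kings] using hv⟩

/-- The coin that decides about redirection: `true` (redirect) has probability `r`, and
`false` (no redirection) has probability `1 - r`. -/
def redirectCoin (r : unitInterval) : PMF Bool :=
  PMF.ofFintype (fun b => cond b (ENNReal.ofReal (r : ℝ)) (ENNReal.ofReal (1 - (r : ℝ)))) (by
    rw [Fintype.sum_bool]
    simp only [cond_true, cond_false]
    rw [← ENNReal.ofReal_add r.2.1 (sub_nonneg.2 r.2.2)]
    simp)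

open Classical in
/-- A uniformly random neighbour of `u`. If `u` has no neighbours (which, in a tree, happens only
in the one-vertex tree), then `u` itself. -/
def randomNeighbor {V : Type*} [Fintype V] (G : SimpleGraph V) (u : V) : PMF V :=
  if h : (G.neighborFinset u).Nonempty then PMF.uniformOfFinset (G.neighborFinset u) h
  else PMF.pure u

/-- The law of the vertex to which the new vertex attaches in the CR model with `α = ∞`: a target is
chosen uniformly among the vertices of highest degree; with probability `1 - r` the
new vertex attaches to the target, and with probability `r` it is redirected to a uniformly
random neighbour of the target. -/
def attachLaw {V : Type*} [Fintype V] [Nonempty V] (r : unitInterval) (G : SimpleGraph V) : PMF V :=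
  (PMF.uniformOfFinset (kings G) (kings_nonempty G)).bind fun u =>
    (redirectCoin r).bind fun b => if b then randomNeighbor G u else PMF.pure u

/-- Attach a new vertex, the last one, to the vertex `v` of `G` by an edge. -/
def attachLeaf {k : ℕ} (G : SimpleGraph (Fin k)) (v : Fin k) : SimpleGraph (Fin (k + 1)) :=
  G.map Fin.castSuccEmb ⊔ SimpleGraph.edge v.castSucc (Fin.last k)

/-- One step of the growth, started from a seed with `m + 1` vertices: the transition
from the graph with `m + n + 1` vertices to the one with one vertex more. -/
def crStep (r : unitInterval) (m n : ℕ) :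
    Kernel (SimpleGraph (Fin (m + n + 1))) (SimpleGraph (Fin (m + (n + 1) + 1))) :=
  Kernel.ofFunOfCountable fun G => ((attachLaw r G).map (attachLeaf G)).toMeasure

instance (r : unitInterval) (m n : ℕ) : IsMarkovKernel (crStep r m n) :=
  ⟨fun G => by unfold crStep; exact PMF.toMeasure.isProbabilityMeasure _⟩

/-- The same step as a kernel on histories; it depends only on the present graph. -/
def crHistoryStep (r : unitInterval) (m n : ℕ) :
    Kernel (∀ i : Finset.Iic n, SimpleGraph (Fin (m + (i : ℕ) + 1)))
      (SimpleGraph (Fin (m + (n + 1) + 1))) :=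
  (crStep r m n).comap (fun h => h ⟨n, Finset.mem_Iic.2 le_rfl⟩) (measurable_pi_apply _)

instance (r : unitInterval) (m n : ℕ) : IsMarkovKernel (crHistoryStep r m n) := by
  unfold crHistoryStep; infer_instance

/-- The law of the CR model with `α = ∞` and redirection probability `r`, grown from `seed`: the law
of the Markov chain `T 0 = seed, T 1, T 2, …` in which `T n` is the graph after `n` vertices
have been added. -/
def crLaw (r : unitInterval) {m : ℕ} (seed : SimpleGraph (Fin (m + 1))) :
    Measure (∀ n : ℕ, SimpleGraph (Fin (m + n + 1))) :=
  Kernel.trajMeasure (X := fun n => SimpleGraph (Fin (m + n + 1)))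
    (Measure.dirac seed) (crHistoryStep r m)

end

/-! ### Degrees, kings and distances after attaching a leaf -/

section AttachLeaf

open Classical SimpleGraph

/-! Let D be the highest degree; call vertices of degree D kings and the others commoners. Once D ≥
1, a new king can only arise from a vertex of degree D - 1. If from some time on no such vertex
exists, the set of kings never grows again; since each new leaf lies within distance 2 of a king,
the diameter stays bounded (`iSup_ediam_lt_top`).

That this gap opens almost surely is a Lyapunov argument. Take `w D * (∑ u, b ^ deg u + C)` with `w
D` equal to `b⁻ᴰ` for large D. Hitting a king, of probability at least 1 - r, raises D and shrinks
the commoners' share by a factor of at least b. A given commoner is hit with probability at most r /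
D, too rarely to compensate. So the potential falls on average by at least δ times the commoners'
share (`sum_attachLaw_mul_potential_le`). The expected shares are therefore summable and the shares
tend to 0 almost surely, whereas a vertex of degree D - 1 would keep the share at least 1 / b
(`inv_le_commonersPotential`). -/

theorem mem_kings_iff {V : Type*} [Fintype V] {G : SimpleGraph V} {v : V} :
    v ∈ kings G ↔ G.degree v = G.maxDegree := by
  simp only [kings, Finset.mem_filter, Finset.mem_univ, true_and]
  constructor
  · intro h
    exact le_antisymm (G.degree_le_maxDegree v) (G.maxDegree_le_of_forall_degree_le _ h)
  · intro h w
    rw [h]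
    exact G.degree_le_maxDegree w

theorem degree_lt_maxDegree {V : Type*} [Fintype V] {G : SimpleGraph V} {v : V}
    (hv : v ∉ kings G) : G.degree v < G.maxDegree :=
  lt_of_le_of_ne (G.degree_le_maxDegree v) fun h => hv (mem_kings_iff.2 h)

variable {k : ℕ} (G : SimpleGraph (Fin k)) (v : Fin k)

@[simp] theorem attachLeaf_adj_castSucc (x y : Fin k) :
    (attachLeaf G v).Adj x.castSucc y.castSucc ↔ G.Adj x y := by
  rw [attachLeaf, SimpleGraph.sup_adj, SimpleGraph.map_adj]
  simp [SimpleGraph.edge_adj, Fin.castSucc_ne_last]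

@[simp] theorem attachLeaf_adj_last (x : Fin k) :
    (attachLeaf G v).Adj x.castSucc (Fin.last k) ↔ x = v := by
  rw [attachLeaf, SimpleGraph.sup_adj, SimpleGraph.map_adj]
  simp [SimpleGraph.edge_adj, Fin.castSucc_ne_last]

@[simp] theorem attachLeaf_last_adj (x : Fin k) :
    (attachLeaf G v).Adj (Fin.last k) x.castSucc ↔ x = v := by
  rw [SimpleGraph.adj_comm, attachLeaf_adj_last]

theorem degree_eq_sum_ite {V : Type*} [Fintype V] (H : SimpleGraph V) (x : V) :
    H.degree x = ∑ y, if H.Adj x y then 1 else 0 := by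
  rw [← Finset.card_filter, ← SimpleGraph.card_neighborFinset_eq_degree,
    SimpleGraph.neighborFinset_eq_filter]

theorem degree_attachLeaf_castSucc (x : Fin k) :
    (attachLeaf G v).degree x.castSucc = G.degree x + if x = v then 1 else 0 := by
  rw [degree_eq_sum_ite, degree_eq_sum_ite, Fin.sum_univ_castSucc]
  simp

theorem degree_attachLeaf_last : (attachLeaf G v).degree (Fin.last k) = 1 := by
  rw [degree_eq_sum_ite, Fin.sum_univ_castSucc]
  simp

theorem maxDegree_attachLeaf_of_mem (hv : v ∈ kings G) :
    (attachLeaf G v).maxDegree = G.maxDegree + 1 := by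
  rw [mem_kings_iff] at hv
  apply le_antisymm
  · refine maxDegree_le_of_forall_degree_le _ _ fun x => ?_
    induction x using Fin.lastCases with
    | last => rw [degree_attachLeaf_last]; omega
    | cast x =>
      rw [degree_attachLeaf_castSucc]
      have := G.degree_le_maxDegree x
      split_ifs <;> omega
  · have := (attachLeaf G v).degree_le_maxDegree v.castSucc
    rw [degree_attachLeaf_castSucc, hv] at this
    simpa using this

theorem maxDegree_attachLeaf_of_notMem (hv : v ∉ kings G) :
    (attachLeaf G v).maxDegree = G.maxDegree := by
  have hlt := degree_lt_maxDegree hv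
  apply le_antisymm
  · refine maxDegree_le_of_forall_degree_le _ _ fun x => ?_
    induction x using Fin.lastCases with
    | last => rw [degree_attachLeaf_last]; omega
    | cast x =>
      rw [degree_attachLeaf_castSucc]
      have := G.degree_le_maxDegree x
      split_ifs with h
      · subst h; omega
      · omega
  · refine maxDegree_le_of_forall_degree_le _ _ fun x => ?_
    have := (attachLeaf G v).degree_le_maxDegree x.castSucc
    rw [degree_attachLeaf_castSucc] at this
    omega

theorem one_le_maxDegree_attachLeaf : 1 ≤ (attachLeaf G v).maxDegree :=
  (degree_attachLeaf_last G v).symm.le.trans (degree_le_maxDegree _ _)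

/-- If no vertex is one short of the highest degree, then no new kings arise. -/
theorem exists_mem_kings_of_mem_kings_attachLeaf (hD : 1 ≤ G.maxDegree)
    (hgap : ∀ x, G.degree x + 1 ≠ G.maxDegree) {y : Fin (k + 1)}
    (hy : y ∈ kings (attachLeaf G v)) : ∃ x ∈ kings G, x.castSucc = y := by
  rw [mem_kings_iff] at hy
  by_cases hv : v ∈ kings G
  · rw [maxDegree_attachLeaf_of_mem G v hv] at hy
    induction y using Fin.lastCases with
    | last => rw [degree_attachLeaf_last] at hy; omega
    | cast x =>
      rw [degree_attachLeaf_castSucc] at hy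
      have := G.degree_le_maxDegree x
      split_ifs at hy with h
      · exact ⟨x, h ▸ hv, rfl⟩
      · omega
  · rw [maxDegree_attachLeaf_of_notMem G v hv] at hy
    have hlt := degree_lt_maxDegree hv
    have := hgap v
    induction y using Fin.lastCases with
    | last =>
      -- The leaf could be a king only if D = 1, but then `v` has degree 0 = D - 1, against the gap.
      rw [degree_attachLeaf_last] at hy
      omega
    | cast x =>
      rw [degree_attachLeaf_castSucc] at hy
      split_ifs at hy with h
      · subst h; omega
      · exact ⟨x, mem_kings_iff.2 hy, rfl⟩

theorem edist_attachLeaf_le (x y : Fin k) :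
    (attachLeaf G v).edist x.castSucc y.castSucc ≤ G.edist x y := by
  by_cases h : G.edist x y = ⊤
  · rw [h]; exact le_top
  · obtain ⟨p, hp⟩ := exists_walk_of_edist_ne_top h
    rw [← hp]
    let f : G →g attachLeaf G v := ⟨Fin.castSucc, fun h => (attachLeaf_adj_castSucc G v _ _).2 h⟩
    exact (edist_le (p.map f)).trans (by rw [Walk.length_map])

theorem edist_attachLeaf_last_le (x : Fin k) :
    (attachLeaf G v).edist x.castSucc (Fin.last k) ≤ G.edist x v + 1 := by
  refine SimpleGraph.edist_triangle.trans (add_le_add (edist_attachLeaf_le G v x v) ?_)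
  rw [edist_le_one_iff_adj_or_eq]
  exact Or.inl ((attachLeaf_adj_last G v v).2 rfl)

end AttachLeaf

/-! ### Bounds on the attachment probabilities -/

noncomputable section

section AttachLaw

open Classical

theorem randomNeighbor_apply_le {V : Type*} [Fintype V] (G : SimpleGraph V) {u v : V} (h : v ≠ u) :
    randomNeighbor G u v ≤ (G.degree u : ENNReal)⁻¹ := by
  rw [randomNeighbor]
  split_ifs with hu
  · rw [PMF.uniformOfFinset_apply]
    split_ifs
    · rfl
    · exact zero_le
  · simp [PMF.pure_apply, h]

variable {V : Type*} [Fintype V] [Nonempty V] (r : unitInterval) (G : SimpleGraph V)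

theorem attachLaw_apply (v : V) :
    attachLaw r G v = ∑ u, PMF.uniformOfFinset (kings G) (kings_nonempty G) u *
      (ENNReal.ofReal r * randomNeighbor G u v + ENNReal.ofReal (1 - r) * PMF.pure u v) := by
  rw [attachLaw, PMF.bind_apply, tsum_fintype]
  refine Finset.sum_congr rfl fun u _ => ?_
  rw [PMF.bind_apply, tsum_fintype, Fintype.sum_bool]
  simp [redirectCoin]

theorem le_attachLaw_apply_of_mem {v : V} :
    PMF.uniformOfFinset (kings G) (kings_nonempty G) v * ENNReal.ofReal (1 - r) ≤
      attachLaw r G v := by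
  rw [attachLaw_apply]
  refine le_trans ?_ (Finset.single_le_sum (fun _ _ => zero_le) (Finset.mem_univ v))
  gcongr
  simp

theorem le_sum_kings_attachLaw :
    ENNReal.ofReal (1 - r) ≤ ∑ v ∈ kings G, attachLaw r G v := by
  have h : ∑ v ∈ kings G, PMF.uniformOfFinset (kings G) (kings_nonempty G) v = 1 := by
    rw [Finset.sum_congr rfl fun v hv => PMF.uniformOfFinset_apply_of_mem _ hv, Finset.sum_const,
      nsmul_eq_mul, ENNReal.mul_inv_cancel]
    · simpa using (kings_nonempty G).ne_empty
    · exact ENNReal.natCast_ne_top _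
  calc ENNReal.ofReal (1 - r)
      = ∑ v ∈ kings G, PMF.uniformOfFinset (kings G) (kings_nonempty G) v *
          ENNReal.ofReal (1 - r) := by rw [← Finset.sum_mul, h, one_mul]
    _ ≤ _ := Finset.sum_le_sum fun v _ => le_attachLaw_apply_of_mem r G

/-- A commoner is reached only by redirection, and every possible target has exactly D neighbours;
averaging over the kings keeps the bound. -/
theorem attachLaw_apply_le {v : V} (hv : v ∉ kings G) :
    attachLaw r G v ≤ ENNReal.ofReal r * (G.maxDegree : ENNReal)⁻¹ := by
  rw [attachLaw_apply]
  calc _ ≤ ∑ u, PMF.uniformOfFinset (kings G) (kings_nonempty G) u *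
        (ENNReal.ofReal r * (G.maxDegree : ENNReal)⁻¹) := by
        refine Finset.sum_le_sum fun u _ => ?_
        by_cases hu : u ∈ kings G
        · have hne : v ≠ u := fun h => hv (h ▸ hu)
          have := randomNeighbor_apply_le G hne
          rw [mem_kings_iff.1 hu] at this
          gcongr
          simpa [PMF.pure_apply, hne] using mul_le_mul_right this (ENNReal.ofReal r)
        · simp [PMF.uniformOfFinset_apply, hu]
    _ = _ := by
        rw [← Finset.sum_mul, ← tsum_fintype (L := .unconditional _), PMF.tsum_coe, one_mul]

theorem exists_king_of_mem_support_attachLaw {v : V} (hv : v ∈ (attachLaw r G).support) :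
    ∃ u ∈ kings G, G.Adj u v ∨ u = v := by
  rw [attachLaw, PMF.mem_support_bind_iff] at hv
  obtain ⟨u, hu, hv⟩ := hv
  refine ⟨u, by simpa using hu, ?_⟩
  rw [PMF.mem_support_bind_iff] at hv
  obtain ⟨c, -, hv⟩ := hv
  cases c with
  | false => right; simpa [eq_comm] using hv
  | true =>
    simp only [if_true, randomNeighbor] at hv
    split_ifs at hv with h
    · left; simpa using hv
    · right; simpa [eq_comm] using hv

theorem sum_toReal_attachLaw : ∑ v, (attachLaw r G v).toReal = 1 := by
  rw [← ENNReal.toReal_sum fun v _ => PMF.apply_ne_top _ _,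
    ← tsum_fintype (L := .unconditional _), PMF.tsum_coe, ENNReal.toReal_one]

theorem le_sum_kings_toReal_attachLaw :
    1 - (r : ℝ) ≤ ∑ v ∈ kings G, (attachLaw r G v).toReal := by
  rw [← ENNReal.toReal_sum fun v _ => PMF.apply_ne_top _ _]
  refine (ENNReal.ofReal_le_iff_le_toReal ?_).1 (le_sum_kings_attachLaw r G)
  exact ENNReal.sum_ne_top.2 fun v _ => PMF.apply_ne_top _ _

theorem toReal_attachLaw_le {v : V} (hv : v ∉ kings G) :
    (attachLaw r G v).toReal ≤ r / G.maxDegree := by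
  have hD : (G.maxDegree : ENNReal) ≠ 0 := by
    have := degree_lt_maxDegree hv
    exact_mod_cast (by omega)
  have h := ENNReal.toReal_mono
    (ENNReal.mul_ne_top ENNReal.ofReal_ne_top (ENNReal.inv_ne_top.2 hD)) (attachLaw_apply_le r G hv)
  rwa [ENNReal.toReal_mul, ENNReal.toReal_ofReal r.2.1, ENNReal.toReal_inv, ENNReal.toReal_natCast,
    ← div_eq_mul_inv] at h

end AttachLaw

end

/-! ### The Lyapunov function and its drift -/

noncomputable section

section Potential

open Classical

/-- The vertices that are not kings. -/
def commoners {V : Type*} [Fintype V] (G : SimpleGraph V) : Finset V := (kings G)ᶜ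

theorem mem_commoners {V : Type*} [Fintype V] {G : SimpleGraph V} {v : V} :
    v ∈ commoners G ↔ v ∉ kings G := Finset.mem_compl

theorem sum_kings_add_sum_commoners {V : Type*} [Fintype V] (G : SimpleGraph V) (f : V → ℝ) :
    ∑ v ∈ kings G, f v + ∑ v ∈ commoners G, f v = ∑ v, f v :=
  Finset.sum_add_sum_compl _ _

/-- The Lyapunov function: each vertex `u` contributes `w D * b ^ deg u`, where `D` is the highest
degree. -/
def potential {V : Type*} [Fintype V] (w : ℕ → ℝ) (b C : ℝ) (G : SimpleGraph V) : ℝ :=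
  w G.maxDegree * (∑ u, b ^ G.degree u + C)

/-- The part of the potential that comes from the vertices that are not kings. -/
def commonersPotential {V : Type*} [Fintype V] (w : ℕ → ℝ) (b : ℝ) (G : SimpleGraph V) : ℝ :=
  w G.maxDegree * ∑ u ∈ commoners G, b ^ G.degree u

/-- The conditions on a weight that make `potential` decrease on average. -/
structure IsDriftWeight (r b δ : ℝ) (w : ℕ → ℝ) : Prop where
  one_lt : 1 < b
  pos : 0 < δ
  mul_succ_le : ∀ D, b * w (D + 1) ≤ w D
  one_le : ∀ D, 1 ≤ w D * b ^ D
  drift : ∀ D, 1 ≤ D → δ * w D + r / D * (b - 1) * w D ≤ (1 - r) * (w D - w (D + 1))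

theorem IsDriftWeight.weight_pos {r b δ : ℝ} {w : ℕ → ℝ} (h : IsDriftWeight r b δ w) (D : ℕ) :
    0 < w D := by
  have hb : 0 < b ^ D := pow_pos (zero_lt_one.trans h.one_lt) D
  exact pos_of_mul_pos_left (zero_lt_one.trans_le (h.one_le D)) hb.le

/-- For D ≥ N, the ratio r / D is small and the weight `b⁻ᴰ` suffices. For smaller D the weight also
halves at each step, which pays for commoners being hit often. -/
theorem exists_isDriftWeight {r : ℝ} (hr0 : 0 ≤ r) (hr : r < 1) :
    ∃ b δ w, IsDriftWeight r b δ w := by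
  obtain ⟨N, hN⟩ := exists_nat_ge (4 / (1 - r))
  have hs : 0 < 1 - r := by linarith
  rw [div_le_iff₀ hs] at hN
  set b : ℝ := 1 + (1 - r) / 4 with hb
  have hb1 : 1 < b := by linarith
  have hb0 : 0 < b := by linarith
  -- Truncated subtraction makes the second factor 1 from `N` on.
  let w : ℕ → ℝ := fun D => (b ^ D)⁻¹ * 2 ^ (N - D)
  have hw0 : ∀ D, 0 < w D := fun D => by positivity
  have hge : ∀ D, N ≤ D → b * w (D + 1) = w D := fun D hD => by
    simp only [w, Nat.sub_eq_zero_of_le hD, Nat.sub_eq_zero_of_le (hD.trans (Nat.le_succ D))]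
    field_simp
    ring
  have hlt : ∀ D, D < N → 2 * (b * w (D + 1)) = w D := fun D hD => by
    have : N - D = N - (D + 1) + 1 := by omega
    simp only [w, this]
    field_simp
    ring
  refine ⟨b, (1 - r) ^ 2 / 16, w, hb1, by positivity, fun D => ?_, fun D => ?_, fun D hD => ?_⟩
  · rcases lt_or_ge D N with h | h
    · have := hlt D h
      have := mul_pos hb0 (hw0 (D + 1))
      linarith
    · exact (hge D h).le
  · simp only [w]
    rw [mul_right_comm, inv_mul_cancel₀ (pow_pos hb0 D).ne', one_mul]
    exact one_le_pow₀ one_le_two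
  · have hD' : (1 : ℝ) ≤ D := by exact_mod_cast hD
    have hpos := hw0 (D + 1)
    rcases lt_or_ge D N with h | h
    · rw [← hlt D h]
      have h1 : r / D ≤ 1 := by rw [div_le_one (by linarith)]; linarith
      have h2 : r / D * (b - 1) ≤ (1 - r) / 4 := by
        rw [hb]; nlinarith
      have h3 : (1 - r) ^ 2 / 16 + r / D * (b - 1) ≤ (1 - r) / 2 := by nlinarith
      have h4 : (1 - r) / 2 * (2 * (b * w (D + 1))) ≤
          (1 - r) * (2 * (b * w (D + 1)) - w (D + 1)) := by
        nlinarith [mul_pos hs hpos, mul_pos (mul_pos hs hpos) (sub_pos.2 hb1)]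
      have := mul_le_mul_of_nonneg_right h3 (by positivity : 0 ≤ 2 * (b * w (D + 1)))
      linarith
    · rw [← hge D h]
      have hND : (N : ℝ) ≤ D := by exact_mod_cast h
      have h1 : r / D ≤ (1 - r) / 4 := by
        rw [div_le_iff₀ (by linarith)]
        nlinarith
      have h3 : ((1 - r) ^ 2 / 16 + r / D * (b - 1)) * b ≤ (1 - r) * (b - 1) := by
        have : r / D * (b - 1) ≤ (1 - r) / 4 * (b - 1) :=
          mul_le_mul_of_nonneg_right h1 (by linarith)
        have hb2 : b ≤ 2 := by linarith
        have h5 : (1 - r) ^ 2 / 16 + r / D * (b - 1) ≤ (1 - r) ^ 2 / 8 := by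
          rw [hb] at this ⊢; nlinarith
        have h6 := mul_le_mul h5 hb2 hb0.le (by positivity)
        rw [hb] at h6 ⊢; nlinarith
      have := mul_le_mul_of_nonneg_right h3 hpos.le
      linarith

theorem sum_pow_degree_attachLeaf {k : ℕ} (b : ℝ) (G : SimpleGraph (Fin k)) (v : Fin k) :
    ∑ u, b ^ (attachLeaf G v).degree u =
      ∑ u, b ^ G.degree u + (b ^ G.degree v * (b - 1) + b) := by
  have h : ∀ u, b ^ (G.degree u + if u = v then 1 else 0) =
      b ^ G.degree u + if u = v then b ^ G.degree v * (b - 1) else 0 := by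
    intro u
    split_ifs with hu
    · rw [hu]; ring
    · simp
  rw [Fin.sum_univ_castSucc, degree_attachLeaf_last]
  simp only [degree_attachLeaf_castSucc, h, Finset.sum_add_distrib, Finset.sum_ite_eq',
    Finset.mem_univ, if_true]
  ring

theorem sum_pow_degree_eq {V : Type*} [Fintype V] (b : ℝ) (G : SimpleGraph V) :
    ∑ u, b ^ G.degree u =
      (kings G).card * b ^ G.maxDegree + ∑ u ∈ commoners G, b ^ G.degree u := by
  rw [← sum_kings_add_sum_commoners G,
    Finset.sum_congr rfl fun u hu => by rw [mem_kings_iff.1 hu], Finset.sum_const, nsmul_eq_mul]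

namespace IsDriftWeight

variable {k : ℕ} {r b δ : ℝ} {w : ℕ → ℝ}

/-- With c ≥ 1 kings, c + b - 1 ≤ b c, so the drop of the weight absorbs the degree gained by the
king. The term `b * w D` bounds the new leaf; the subtracted term is what the commoners and `C`
lose. -/
theorem potential_attachLeaf_le_of_mem (h : IsDriftWeight r b δ w) {C : ℝ} {G : SimpleGraph (Fin k)}
    {v : Fin k} (hv : v ∈ kings G) :
    potential w b C (attachLeaf G v) ≤ potential w b C G + b * w G.maxDegree -
      (w G.maxDegree - w (G.maxDegree + 1)) * (∑ u ∈ commoners G, b ^ G.degree u + C) := by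
  have hb := h.one_lt
  have hw := h.weight_pos G.maxDegree
  have hw' := h.weight_pos (G.maxDegree + 1)
  have hle := h.mul_succ_le G.maxDegree
  have hc : (1 : ℝ) ≤ (kings G).card := by
    exact_mod_cast Finset.card_pos.2 ⟨v, hv⟩
  rw [potential, potential, maxDegree_attachLeaf_of_mem G v hv, sum_pow_degree_attachLeaf,
    sum_pow_degree_eq, mem_kings_iff.1 hv]
  set D := G.maxDegree
  set S := ∑ u ∈ commoners G, b ^ G.degree u
  have hp : 0 < b ^ D := pow_pos (by linarith) D
  have h1 : w (D + 1) * ((kings G).card + (b - 1)) ≤ w D * (kings G).card := by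
    nlinarith [mul_nonneg (mul_nonneg hw'.le (sub_nonneg.2 hc)) (sub_nonneg.2 hb.le)]
  have h2 := mul_le_mul_of_nonneg_right h1 hp.le
  have h3 : w (D + 1) * b ≤ b * w D := by nlinarith
  linarith

theorem potential_attachLeaf_of_notMem {C : ℝ} {G : SimpleGraph (Fin k)}
    {v : Fin k} (hv : v ∉ kings G) :
    potential w b C (attachLeaf G v) = potential w b C G + b * w G.maxDegree +
      w G.maxDegree * (b - 1) * b ^ G.degree v := by
  rw [potential, potential, maxDegree_attachLeaf_of_notMem G v hv, sum_pow_degree_attachLeaf]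
  ring

theorem sum_attachLaw_mul_potential_le [Nonempty (Fin k)] {r : unitInterval}
    (h : IsDriftWeight r b δ w) {C : ℝ} (hr : r < 1) (hC0 : 0 ≤ C)
    (hC : b ^ 2 ≤ (1 - (r : ℝ)) * (b - 1) * C) (G : SimpleGraph (Fin k)) :
    ∑ v, (attachLaw r G v).toReal * potential w b C (attachLeaf G v) +
      δ * commonersPotential w b G ≤ potential w b C G := by
  have hb := h.one_lt
  have hw := h.weight_pos G.maxDegree
  have hle := h.mul_succ_le G.maxDegree
  have hs : 0 < 1 - (r : ℝ) := sub_pos.2 hr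
  have hsum := sum_toReal_attachLaw r G
  have hking := le_sum_kings_toReal_attachLaw r G
  set D := G.maxDegree with hD
  set S := ∑ u ∈ commoners G, b ^ G.degree u with hS
  set p : Fin k → ℝ := fun v => (attachLaw r G v).toReal with hp
  have hp0 : ∀ v, 0 ≤ p v := fun v => ENNReal.toReal_nonneg
  have hS0 : 0 ≤ S := Finset.sum_nonneg fun u _ => pow_nonneg (by linarith) _
  have hΔ : (b - 1) * w D ≤ b * (w D - w (D + 1)) := by linarith
  have hΔ0 : 0 ≤ w D - w (D + 1) := by
    have := mul_pos (sub_pos.2 hb) hw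
    exact (pos_of_mul_pos_right (this.trans_le hΔ) (by linarith)).le
  have h1 : ∑ v ∈ kings G, p v * potential w b C (attachLeaf G v) ≤
      ∑ v ∈ kings G, p v * (potential w b C G + b * w D) -
        (∑ v ∈ kings G, p v) * ((w D - w (D + 1)) * (S + C)) := by
    rw [Finset.sum_mul, ← Finset.sum_sub_distrib]
    refine Finset.sum_le_sum fun v hv => ?_
    rw [← mul_sub]
    exact mul_le_mul_of_nonneg_left (h.potential_attachLeaf_le_of_mem hv) (hp0 v)
  have h2 : ∑ v ∈ commoners G, p v * potential w b C (attachLeaf G v) ≤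
      ∑ v ∈ commoners G, p v * (potential w b C G + b * w D) +
        r / D * (b - 1) * w D * S := by
    rw [hS, Finset.mul_sum, ← Finset.sum_add_distrib]
    refine Finset.sum_le_sum fun v hv => ?_
    have hv := mem_commoners.1 hv
    rw [potential_attachLeaf_of_notMem hv, mul_add]
    refine add_le_add_right ?_ _
    have := mul_le_mul_of_nonneg_right (toReal_attachLaw_le r G hv)
      (mul_nonneg (mul_nonneg hw.le (sub_nonneg.2 hb.le))
        (pow_nonneg (zero_lt_one.trans hb).le (G.degree v)))
    calc _ ≤ _ := this
      _ = _ := by ring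
  have h3 : (1 - (r : ℝ)) * ((w D - w (D + 1)) * (S + C)) ≤
      (∑ v ∈ kings G, p v) * ((w D - w (D + 1)) * (S + C)) :=
    mul_le_mul_of_nonneg_right hking (by positivity)
  -- The constant `C` is there to pay for the new leaf.
  have h4 : b * w D ≤ (1 - (r : ℝ)) * (w D - w (D + 1)) * C := by
    have e1 := mul_le_mul_of_nonneg_left hΔ (mul_nonneg hs.le hC0)
    have e2 := mul_le_mul_of_nonneg_right hC hw.le
    refine le_of_mul_le_mul_left ?_ (zero_lt_one.trans hb)
    linarith
  have h5 : δ * w D * S + r / D * (b - 1) * w D * S ≤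
      (1 - (r : ℝ)) * (w D - w (D + 1)) * S := by
    -- The drift condition needs D ≥ 1, which a commoner guarantees.
    rcases (commoners G).eq_empty_or_nonempty with he | ⟨v, hv⟩
    · simp [hS, he]
    · rw [← add_mul]
      refine mul_le_mul_of_nonneg_right (h.drift D ?_) hS0
      have := degree_lt_maxDegree (mem_commoners.1 hv)
      omega
  have h6 : ∑ v ∈ kings G, p v * (potential w b C G + b * w D) +
      ∑ v ∈ commoners G, p v * (potential w b C G + b * w D) =
        potential w b C G + b * w D := by
    rw [sum_kings_add_sum_commoners, ← Finset.sum_mul, hsum, one_mul]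
  rw [← sum_kings_add_sum_commoners G, commonersPotential, ← hS, ← hD]
  linarith

theorem potential_nonneg {V : Type*} [Fintype V] (h : IsDriftWeight r b δ w) {C : ℝ} (hC0 : 0 ≤ C)
    (G : SimpleGraph V) : 0 ≤ potential w b C G :=
  mul_nonneg (h.weight_pos _).le (add_nonneg
    (Finset.sum_nonneg fun _ _ => pow_nonneg (zero_lt_one.trans h.one_lt).le _) hC0)

theorem commonersPotential_nonneg {V : Type*} [Fintype V] (h : IsDriftWeight r b δ w)
    (G : SimpleGraph V) : 0 ≤ commonersPotential w b G :=
  mul_nonneg (h.weight_pos _).le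
    (Finset.sum_nonneg fun _ _ => pow_nonneg (zero_lt_one.trans h.one_lt).le _)

theorem inv_le_commonersPotential {V : Type*} [Fintype V] (h : IsDriftWeight r b δ w)
    {G : SimpleGraph V} {x : V} (hx : G.degree x + 1 = G.maxDegree) :
    b⁻¹ ≤ commonersPotential w b G := by
  have hb : 0 < b := zero_lt_one.trans h.one_lt
  have hmem : x ∈ commoners G := by
    rw [mem_commoners, mem_kings_iff]
    omega
  have h1 := h.one_le G.maxDegree
  refine le_trans ?_ (mul_le_mul_of_nonneg_left
    (Finset.single_le_sum (fun u _ => pow_nonneg hb.le (G.degree u)) hmem) (h.weight_pos _).le)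
  rw [inv_le_iff_one_le_mul₀ hb]
  rw [← hx, pow_succ] at h1
  rw [← hx]
  linarith

end IsDriftWeight

end Potential

end

/-! ### Bounded diameter once the gap is open -/

noncomputable section

section Growth

open Classical SimpleGraph

theorem eccent_attachLeaf_le {k : ℕ} [NeZero k] (G : SimpleGraph (Fin k)) (v : Fin k) :
    (attachLeaf G v).eccent 0 ≤ G.eccent 0 + 1 := by
  rw [eccent_le_iff, ← Fin.castSucc_zero']
  intro y
  induction y using Fin.lastCases with
  | last => exact (edist_attachLeaf_last_le G v 0).trans (by gcongr; exact edist_le_eccent)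
  | cast y => exact (edist_attachLeaf_le G v 0 y).trans (edist_le_eccent.trans le_self_add)

/-- A growing sequence of connected graphs, in which every new leaf is attached at distance at most
one from a king, has bounded diameter if eventually no vertex is one short of the highest degree. -/
theorem iSup_ediam_lt_top {m : ℕ} {T : ∀ n : ℕ, SimpleGraph (Fin (m + n + 1))}
    (h0 : (T 0).Connected)
    (hstep : ∀ n, ∃ v, (∃ u ∈ kings (T n), (T n).Adj u v ∨ u = v) ∧
      T (n + 1) = attachLeaf (T n) v)
    (hgap : ∀ᶠ n in Filter.atTop, ∀ x, (T n).degree x + 1 ≠ (T n).maxDegree) :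
    (⨆ n : ℕ, (T n).ediam) < ⊤ := by
  have hfin : ∀ n, ∃ R : ℕ, (T n).eccent 0 ≤ R := by
    intro n
    induction n with
    | zero =>
      obtain ⟨y, hy⟩ := exists_edist_eq_eccent_of_finite (G := T 0) 0
      rw [← hy]
      obtain ⟨R, hR⟩ := ENat.ne_top_iff_exists.1 (edist_ne_top_iff_reachable.2 (h0 0 y))
      exact ⟨R, hR.ge⟩
    | succ n ih =>
      obtain ⟨R, hR⟩ := ih
      obtain ⟨v, -, hv⟩ := hstep n
      refine ⟨R + 1, ?_⟩
      rw [hv]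
      refine (eccent_attachLeaf_le _ _).trans ?_
      push_cast
      gcongr
  obtain ⟨N, hN⟩ := Filter.eventually_atTop.1 hgap
  -- Starting at `N + 1` rather than `N` ensures that a leaf has been attached, hence D ≥ 1 even for
  -- a one-vertex seed.
  obtain ⟨R, hR⟩ := hfin (N + 1)
  have hlate : ∀ n, N + 1 ≤ n →
      (∀ x ∈ kings (T n), (T n).edist 0 x ≤ R) ∧ (T n).eccent 0 ≤ R + 2 := by
    intro n hn
    induction n, hn using Nat.le_induction with
    | base => exact ⟨fun x _ => edist_le_eccent.trans hR, hR.trans le_self_add⟩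
    | succ n hn ih =>
      obtain ⟨hk, he⟩ := ih
      obtain ⟨v, ⟨u, hu, huv⟩, hv⟩ := hstep n
      have hD : 1 ≤ (T n).maxDegree := by
        obtain ⟨j, rfl⟩ := Nat.exists_eq_add_of_le' (Nat.one_le_of_lt hn)
        obtain ⟨v', -, hv'⟩ := hstep j
        rw [hv']
        exact one_le_maxDegree_attachLeaf _ _
      rw [hv]
      constructor
      · intro y hy
        obtain ⟨x, hx, rfl⟩ := exists_mem_kings_of_mem_kings_attachLeaf _ _ hD (hN n (by omega)) hy
        exact (edist_attachLeaf_le (T n) v 0 x).trans (hk x hx)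
      · rw [eccent_le_iff]
        intro y
        induction y using Fin.lastCases with
        | last =>
          refine (edist_attachLeaf_last_le (T n) v 0).trans ?_
          have h1 : (T n).edist 0 v ≤ R + 1 :=
            SimpleGraph.edist_triangle.trans
              (add_le_add (hk u hu) (edist_le_one_iff_adj_or_eq.2 huv))
          calc _ ≤ (R : ℕ∞) + 1 + 1 := by gcongr
            _ = R + 2 := by rw [add_assoc, one_add_one_eq_two]
        | cast x => exact (edist_attachLeaf_le (T n) v 0 x).trans (edist_le_eccent.trans he)
  choose ρ hρ using hfin
  have hall : ∀ n, (T n).eccent 0 ≤ (((Finset.range (N + 1)).sup ρ + (R + 2) : ℕ) : ℕ∞) := by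
    intro n
    rcases lt_or_ge n (N + 1) with h | h
    · refine (hρ n).trans ?_
      have := Finset.le_sup (f := ρ) (Finset.mem_range.2 h)
      exact_mod_cast this.trans le_self_add
    · refine (hlate n h).2.trans ?_
      exact_mod_cast le_add_self
  refine lt_of_le_of_lt (iSup_le fun n => (ediam_le_two_mul_eccent (0 : Fin (m + n + 1))).trans
    (mul_le_mul_right (hall n) 2)) ?_
  exact_mod_cast ENat.natCast_lt_top (2 * ((Finset.range (N + 1)).sup ρ + (R + 2)))

end Growth

/-! ### The Markov chain and summability of the commoners' share -/

section Chain

theorem lintegral_crStep (r : unitInterval) (m n : ℕ) (G : SimpleGraph (Fin (m + n + 1)))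
    (f : SimpleGraph (Fin (m + (n + 1) + 1)) → ENNReal) :
    ∫⁻ H, f H ∂(crStep r m n G) = ∑ v, attachLaw r G v * f (attachLeaf G v) := by
  have h : crStep r m n G = (attachLaw r G).toMeasure.map (attachLeaf G) :=
    (PMF.toMeasure_map (attachLeaf G) _ .of_discrete).symm
  rw [h, lintegral_map .of_discrete .of_discrete, lintegral_fintype]
  refine Finset.sum_congr rfl fun v _ => ?_
  rw [PMF.toMeasure_apply_singleton _ _ (measurableSet_singleton v), mul_comm]

theorem measurable_eval_eval_succ {m : ℕ} (n : ℕ)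
    (g : SimpleGraph (Fin (m + n + 1)) → SimpleGraph (Fin (m + (n + 1) + 1)) → ENNReal) :
    Measurable fun T : ∀ n : ℕ, SimpleGraph (Fin (m + n + 1)) => g (T n) (T (n + 1)) := by
  have hg : Measurable fun p : SimpleGraph (Fin (m + n + 1)) ×
    SimpleGraph (Fin (m + (n + 1) + 1)) => g p.1 p.2 := .of_discrete
  have hT : Measurable fun T : ∀ n : ℕ, SimpleGraph (Fin (m + n + 1)) => (T n, T (n + 1)) := by
    fun_prop
  exact hg.comp hT

variable (r : unitInterval) {m : ℕ} (seed : SimpleGraph (Fin (m + 1)))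

/-- The one-step Markov property; all later facts about transitions follow from it by a choice of
`g`. -/
theorem lintegral_crLaw_step (n : ℕ)
    (g : SimpleGraph (Fin (m + n + 1)) → SimpleGraph (Fin (m + (n + 1) + 1)) → ENNReal) :
    ∫⁻ T, g (T n) (T (n + 1)) ∂(crLaw r seed) =
      ∫⁻ T, ∑ v, attachLaw r (T n) v * g (T n) (attachLeaf (T n) v) ∂(crLaw r seed) := by
  have key := Kernel.map_frestrictLe_trajMeasure_compProd_eq_map_trajMeasure
    (X := fun n => SimpleGraph (Fin (m + n + 1))) (μ₀ := Measure.dirac seed)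
    (κ := crHistoryStep r m) (a := n)
  change (crLaw r seed).map _ ⊗ₘ _ = (crLaw r seed).map _ at key
  let F : (∀ i : Finset.Iic n, SimpleGraph (Fin (m + (i : ℕ) + 1))) ×
      SimpleGraph (Fin (m + (n + 1) + 1)) → ENNReal :=
    fun p => g (p.1 ⟨n, Finset.mem_Iic.2 le_rfl⟩) p.2
  have hF : Measurable F := .of_discrete
  have h1 := lintegral_map (μ := crLaw r seed) hF
    (g := fun x => (Preorder.frestrictLe n x, x (n + 1))) (by fun_prop)
  rw [← key, Measure.lintegral_compProd hF,
    lintegral_map .of_discrete (Preorder.measurable_frestrictLe n)] at h1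
  refine h1.symm.trans (lintegral_congr fun T => ?_)
  exact lintegral_crStep r m n (T n) (g (T n))

theorem ae_crLaw_zero : ∀ᵐ T ∂(crLaw r seed), T 0 = seed := by
  let X : ℕ → Type := fun n => SimpleGraph (Fin (m + n + 1))
  let e : X 0 → ∀ i : Finset.Iic 0, X i :=
    (MeasurableEquiv.piUnique fun i : Finset.Iic 0 => X i).symm
  have he : Measurable e := MeasurableEquiv.measurable _
  have h : (crLaw r seed).map (Preorder.frestrictLe 0) = (Measure.dirac seed).map e := by
    rw [crLaw, Kernel.trajMeasure, Measure.map_comp _ _ (by fun_prop), Kernel.traj_map_frestrictLe,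
      Kernel.partialTraj_self, Measure.id_comp]
    rfl
  replace h := h.trans (Measure.map_dirac' he seed)
  have h2 : ∀ᵐ x ∂((crLaw r seed).map (Preorder.frestrictLe 0)),
      x ⟨0, Finset.mem_Iic.2 le_rfl⟩ = seed := by
    rw [h, ae_dirac_iff .of_discrete]
    rfl
  exact ae_of_ae_map (Preorder.measurable_frestrictLe 0).aemeasurable h2

theorem ae_crLaw_step (n : ℕ) : ∀ᵐ T ∂(crLaw r seed), ∃ v ∈ (attachLaw r (T n)).support,
    T (n + 1) = attachLeaf (T n) v := by
  classical
  -- The indicator of an impossible transition has integral zero.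
  have h := lintegral_crLaw_step r seed n fun G H =>
    if ∃ v ∈ (attachLaw r G).support, H = attachLeaf G v then 0 else 1
  have h0 : ∀ T : ∀ n : ℕ, SimpleGraph (Fin (m + n + 1)), ∑ v, attachLaw r (T n) v *
      (if ∃ u ∈ (attachLaw r (T n)).support, attachLeaf (T n) v = attachLeaf (T n) u
        then 0 else 1) = 0 := by
    intro T
    refine Finset.sum_eq_zero fun v _ => ?_
    by_cases hv : v ∈ (attachLaw r (T n)).support
    · rw [if_pos ⟨v, hv, rfl⟩, mul_zero]
    · rw [PMF.mem_support_iff, not_not] at hv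
      rw [hv, zero_mul]
  simp only [h0, lintegral_zero] at h
  rw [lintegral_eq_zero_iff] at h
  · filter_upwards [h] with T hT
    by_contra hc
    exact hc (by simpa using hT)
  · exact measurable_eval_eval_succ n fun G H =>
      if ∃ v ∈ (attachLaw r G).support, H = attachLeaf G v then 0 else 1

theorem IsDriftWeight.lintegral_potential_succ_le {b δ C : ℝ} {w : ℕ → ℝ}
    (h : IsDriftWeight r b δ w) (hr : r < 1) (hC0 : 0 ≤ C)
    (hC : b ^ 2 ≤ (1 - (r : ℝ)) * (b - 1) * C) (n : ℕ) :
    ∫⁻ T, ENNReal.ofReal (potential w b C (T (n + 1))) ∂(crLaw r seed) +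
      ENNReal.ofReal δ * ∫⁻ T, ENNReal.ofReal (commonersPotential w b (T n)) ∂(crLaw r seed) ≤
    ∫⁻ T, ENNReal.ofReal (potential w b C (T n)) ∂(crLaw r seed) := by
  have hm : Measurable fun T : ∀ n : ℕ, SimpleGraph (Fin (m + n + 1)) =>
      ENNReal.ofReal (commonersPotential w b (T n)) :=
    (Measurable.of_discrete (f := fun G => ENNReal.ofReal (commonersPotential w b G))).comp
      (measurable_pi_apply n)
  rw [lintegral_crLaw_step r seed n fun _ H => ENNReal.ofReal (potential w b C H),
    ← lintegral_const_mul _ hm, ← lintegral_add_right _ (hm.const_mul _)]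
  refine lintegral_mono fun T => ?_
  have h1 : ∀ v, attachLaw r (T n) v * ENNReal.ofReal (potential w b C (attachLeaf (T n) v)) =
      ENNReal.ofReal ((attachLaw r (T n) v).toReal * potential w b C (attachLeaf (T n) v)) := by
    intro v
    rw [ENNReal.ofReal_mul ENNReal.toReal_nonneg, ENNReal.ofReal_toReal (PMF.apply_ne_top _ _)]
  have h2 : ∀ v, 0 ≤ (attachLaw r (T n) v).toReal * potential w b C (attachLeaf (T n) v) :=
    fun v => mul_nonneg ENNReal.toReal_nonneg (h.potential_nonneg hC0 _)
  simp only [h1]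
  rw [← ENNReal.ofReal_sum_of_nonneg fun v _ => h2 v, ← ENNReal.ofReal_mul h.pos.le,
    ← ENNReal.ofReal_add (Finset.sum_nonneg fun v _ => h2 v)
      (mul_nonneg h.pos.le (h.commonersPotential_nonneg _))]
  exact ENNReal.ofReal_le_ofReal (h.sum_attachLaw_mul_potential_le hr hC0 hC (T n))

/-- The drift inequality telescopes: δ times the sum of the expected shares is at most the potential
of the seed. By Tonelli the series of shares converges almost surely, so no martingale theorem is
needed. -/
theorem ae_eventually_commonersPotential_lt {b δ : ℝ} {w : ℕ → ℝ}
    (h : IsDriftWeight r b δ w) (hr : r < 1) {ε : ℝ} (hε : 0 < ε) :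
    ∀ᵐ T ∂(crLaw r seed), ∀ᶠ n in Filter.atTop, commonersPotential w b (T n) < ε := by
  have hs : 0 < 1 - (r : ℝ) := sub_pos.2 hr
  have hsb : 0 < (1 - (r : ℝ)) * (b - 1) := mul_pos hs (sub_pos.2 h.one_lt)
  set C : ℝ := b ^ 2 / ((1 - (r : ℝ)) * (b - 1)) with hCdef
  have hC0 : 0 ≤ C := by positivity
  have hC : b ^ 2 ≤ (1 - (r : ℝ)) * (b - 1) * C := by
    rw [hCdef, mul_div_cancel₀ _ hsb.ne']
  have hm : ∀ n, Measurable fun T : ∀ n : ℕ, SimpleGraph (Fin (m + n + 1)) =>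
      ENNReal.ofReal (commonersPotential w b (T n)) := fun n =>
    (Measurable.of_discrete (f := fun G => ENNReal.ofReal (commonersPotential w b G))).comp
      (measurable_pi_apply n)
  have hsum : ∀ n, ∫⁻ T, ENNReal.ofReal (potential w b C (T n)) ∂(crLaw r seed) +
      ∑ i ∈ Finset.range n, ENNReal.ofReal δ *
        ∫⁻ T, ENNReal.ofReal (commonersPotential w b (T i)) ∂(crLaw r seed) ≤
      ENNReal.ofReal (potential w b C seed) := by
    intro n
    induction n with
    | zero =>
      rw [Finset.sum_range_zero, add_zero]
      have : ∀ᵐ T ∂(crLaw r seed), ENNReal.ofReal (potential w b C (T 0)) =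
          ENNReal.ofReal (potential w b C seed) := by
        filter_upwards [ae_crLaw_zero r seed] with T hT
        rw [hT]
      rw [lintegral_congr_ae this, lintegral_const]
      have : IsProbabilityMeasure (crLaw r seed) := by unfold crLaw; infer_instance
      simp
    | succ n ih =>
      refine le_trans ?_ ih
      rw [Finset.sum_range_succ, add_comm (∑ i ∈ _, _), ← add_assoc]
      gcongr
      exact h.lintegral_potential_succ_le r seed hr hC0 hC n
  have htsum : ENNReal.ofReal δ * ∑' n, ∫⁻ T, ENNReal.ofReal (commonersPotential w b (T n))
      ∂(crLaw r seed) ≤ ENNReal.ofReal (potential w b C seed) := by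
    rw [← ENNReal.tsum_mul_left, ENNReal.tsum_eq_iSup_nat]
    exact iSup_le fun n => le_add_self.trans (hsum n)
  have hfin : ∑' n, ∫⁻ T, ENNReal.ofReal (commonersPotential w b (T n)) ∂(crLaw r seed) ≠ ⊤ := by
    intro htop
    rw [htop, ENNReal.mul_top (ENNReal.ofReal_pos.2 h.pos).ne'] at htsum
    exact ENNReal.ofReal_ne_top (top_le_iff.1 htsum)
  rw [← lintegral_tsum fun n => (hm n).aemeasurable] at hfin
  filter_upwards [ae_lt_top (Measurable.tsum hm) hfin] with T hT
  have ht := ENNReal.tendsto_atTop_zero_of_tsum_ne_top hT.ne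
  filter_upwards [ht.eventually_lt_const (ENNReal.ofReal_pos.2 hε)] with n hn
  exact (ENNReal.ofReal_lt_ofReal_iff hε).1 hn

end Chain

end

/-! ### Conclusion -/

theorem mainTheorem10 (r : unitInterval) (hr : r < 1) {m : ℕ} (seed : SimpleGraph (Fin (m + 1)))
    (hseed : seed.IsTree) :
    ∀ᵐ T ∂(crLaw r seed), (⨆ n : ℕ, (T n).ediam) < ⊤ := by
  classical
  obtain ⟨b, δ, w, h⟩ := exists_isDriftWeight r.2.1 hr
  have hb : 0 < b⁻¹ := inv_pos.2 (zero_lt_one.trans h.one_lt)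
  filter_upwards [ae_crLaw_zero r seed, ae_all_iff.2 (ae_crLaw_step r seed),
    ae_eventually_commonersPotential_lt r seed h hr hb] with T h0 hstep hT
  refine iSup_ediam_lt_top (h0 ▸ hseed.connected) (fun n => ?_) ?_
  · obtain ⟨v, hv, hTv⟩ := hstep n
    exact ⟨v, exists_king_of_mem_support_attachLaw r _ hv, hTv⟩
  · filter_upwards [hT] with n hn x hx
    exact hn.not_ge (h.inv_le_commonersPotential (by convert hx))
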